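/- Let $\Sigma^*$ be the set of finite binary strings and $|p|$ the length of $p\in\Sigma^*$. A \emph{computer} is a partial recursive function $C\colon\Sigma^*\to\Sigma^*$ whose domain is prefix-free. A computer $U$ is \emph{optimal} if for every computer $C$ there is a constant $d$ such that whenever $C(p)$ is defined there is a $p'$ with $U(p')=C(p)$ and $|p'|\le|p|+d$. Fix an optimal computer $U$, and put $K(s)=\min\{|p| : U(p)=s\}$ and $P(s)=\sum_{U(p)=s}2^{-|p|}$ for $s\in\Sigma^*$. Fix a positive integer $N$. For $N\times N$ Hermitian matrices write $A\leqslant B$ if $B-A$ is positive semi-definite. A \emph{semi-POVM} is a map $R$ from $\Sigma^*$ to the $N\times N$ Hermitian matrices with $0\leqslant R(s)$ for all $s$ and $\sum_{s\in\Sigma^*}R(s)\leqslant I$. It is \emph{lower-computable} if there is a total recursive function $f$ from $\mathbb{N}\times\Sigma^*$ to the $N\times N$ Hermitian matrices with entries in $\mathbb{Q}+i\mathbb{Q}$ such that, for each $s$, $\lim_{n\to\infty}f(n,s)=R(s)$ and $f(n,s)\leqslant R(s)$ for all $n$. A lower-computable semi-POVM $M$ is \emph{universal} if for each lower-computable semi-POVM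 $R$ there is a real $c>0$ with $c\,R(s)\leqslant M(s)$ for all $s\in\Sigma^*$. A \emph{density matrix} is an $N\times N$ positive semi-definite Hermitian matrix of trace $1$. \textbf{Theorem.} Let $M$ be a universal semi-POVM. Then $$K(s)=-\log_2\operatorname{tr}(\rho M(s))+O(1)\qquad\text{and}\qquad P(s)\sim\operatorname{tr}(\rho M(s)),$$ uniformly in $\rho$ and $s$. That is: there is a real $c>0$ such that, for every density matrix $\rho$ and every $s\in\Sigma^*$, $\operatorname{tr}(\rho M(s))>0$ and $|K(s)+\log_2\operatorname{tr}(\rho M(s))|\le c$; and there is a real $c'>0$ such that, for every density matrix $\rho$ and every $s\in\Sigma^*$, $c'P(s)\le\operatorname{tr}(\rho M(s))$ and $c'\operatorname{tr}(\rho M(s))\le P(s)$. -/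

import Mathlib

open scoped ComplexOrder

namespace SemiPOVM

/-! ### Computers, program-size complexity, algorithmic probability

Finite binary strings are `List Bool`. -/

/-- A computer: a partial recursive function on strings with prefix-free domain. -/
structure IsComputer (C : List Bool →. List Bool) : Prop where
  partrec : Partrec C
  prefixFree : ∀ p q : List Bool, (C p).Dom → (C q).Dom → p <+: q → p = q

/-- An optimal computer: it simulates every computer with a constant overhead in length. -/
structure IsOptimalComputer (U : List Bool →. List Bool) : Prop where
  isComputer : IsComputer U
  simulates : ∀ C : List Bool →. List Bool, IsComputer C →
    ∃ sim : ℕ, ∀ p t : List Bool, t ∈ C p →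
      ∃ p' : List Bool, t ∈ U p' ∧ p'.length ≤ p.length + sim

/-- Program-size complexity `K_C(s) = min {|p| : C(p) = s}`, equal to `⊤` if `s` has no program. -/
noncomputable def complexity (C : List Bool →. List Bool) (s : List Bool) : ℕ∞ :=
  ⨅ p : {p : List Bool // s ∈ C p}, (p.1.length : ℕ∞)

/-- Algorithmic probability `P_C(s) = ∑_{C(p) = s} 2^{-|p|}`, with values in `[0, ∞]`. -/
noncomputable def algProb (C : List Bool →. List Bool) (s : List Bool) : ENNReal :=
  ∑' p : {p : List Bool // s ∈ C p}, (2 : ENNReal)⁻¹ ^ p.1.length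

/-! ### Recursive functions with values in rational matrices -/

/-- A function to `ℚ` is total recursive if a total recursive function returns, for each argument,
a triple `(a, b, d)` of natural numbers with value `(a - b) / (d + 1)`. -/
def IsRecursiveRat {α : Type} [Primcodable α] (g : α → ℚ) : Prop :=
  ∃ code : α → ℕ × ℕ × ℕ, Computable code ∧
    ∀ x, g x = (((code x).1 : ℚ) - ((code x).2.1 : ℚ)) / (((code x).2.2 : ℚ) + 1)

/-- `f` takes values in the Hermitian matrices with entries in `ℚ + iℚ` and is total recursive:
the real and imaginary part of each of the finitely many entries are recursive. -/
structure IsRecursiveHermRat {N : ℕ} (f : ℕ → List Bool → Matrix (Fin N) (Fin N) ℂ) : Prop where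
  isHermitian : ∀ n s, (f n s).IsHermitian
  recursive : ∀ i j, ∃ a b : ℕ × List Bool → ℚ, IsRecursiveRat a ∧ IsRecursiveRat b ∧
    ∀ n s, f n s i j = (a (n, s) : ℂ) + (b (n, s) : ℂ) * Complex.I

/-! ### Semi-POVMs

For Hermitian `A`, `B`, the relation `A ≤ B` is written out as `(B - A).PosSemidef`. -/

/-- A semi-POVM on the set of strings: `0 ≤ R(s)` and `∑ R(s) ≤ I`. -/
structure IsSemiPOVM {N : ℕ} (R : List Bool → Matrix (Fin N) (Fin N) ℂ) : Prop where
  posSemidef : ∀ s, (R s).PosSemidef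
  summable : Summable R
  tsum_le_one : (1 - ∑' s, R s).PosSemidef

/-- A lower-computable semi-POVM: the pointwise limit from below of a recursive sequence. -/
structure IsLowerComputable {N : ℕ} (R : List Bool → Matrix (Fin N) (Fin N) ℂ) : Prop where
  isSemiPOVM : IsSemiPOVM R
  approx : ∃ f : ℕ → List Bool → Matrix (Fin N) (Fin N) ℂ, IsRecursiveHermRat f ∧
    ∀ s, Filter.Tendsto (fun n => f n s) Filter.atTop (nhds (R s)) ∧
      ∀ n, (R s - f n s).PosSemidef

/-- A universal semi-POVM: a lower-computable semi-POVM dominating, up to a positive constant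
factor, every lower-computable semi-POVM. -/
structure IsUniversal {N : ℕ} (M : List Bool → Matrix (Fin N) (Fin N) ℂ) : Prop where
  isLowerComputable : IsLowerComputable M
  dominates : ∀ R : List Bool → Matrix (Fin N) (Fin N) ℂ, IsLowerComputable R →
    ∃ c : ℝ, 0 < c ∧ ∀ s, (M s - c • R s).PosSemidef

/-- A density matrix: positive semi-definite of trace one. -/
structure IsDensityMatrix {N : ℕ} (ρ : Matrix (Fin N) (Fin N) ℂ) : Prop where
  posSemidef : ρ.PosSemidef
  trace_eq_one : ρ.trace = 1

/-- The number `tr(ρ A)`, which is real for Hermitian `ρ` and `A`. -/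
noncomputable def outcomeProb {N : ℕ} (ρ A : Matrix (Fin N) (Fin N) ℂ) : ℝ :=
  (ρ * A).trace.re

theorem trace_mul_eq_outcomeProb {N : ℕ} {ρ A : Matrix (Fin N) (Fin N) ℂ}
    (hρ : ρ.IsHermitian) (hA : A.IsHermitian) : (ρ * A).trace = (outcomeProb ρ A : ℂ) := by
  have h : star (ρ * A).trace = (ρ * A).trace := by
    rw [← Matrix.trace_conjTranspose, Matrix.conjTranspose_mul, hρ.eq, hA.eq, Matrix.trace_mul_comm]
  exact (Complex.conj_eq_iff_re.mp h).symm

end SemiPOVM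

/-! Everything reduces to one chain of inequalities, with constants `a, b > 0` depending on neither
`ρ` nor `s`: `a * 2^{-K(s)} ≤ a * P(s) ≤ tr(ρ M(s)) ≤ b * 2^{-K(s)} ≤ b * P(s)`. The outer
comparisons hold because a shortest program is one term of `P(s)`.

Lower bound: `s ↦ P(s) I` is itself a lower-computable semi-POVM
(`isLowerComputable_algProb_smul_one`). Kraft's inequality bounds its sum, and running the computer
for ever more steps approximates it from below. Universality gives `a P(s) I ≤ M(s)`, and pairing
with `ρ` of trace one removes the matrix.

Upper bound: a density matrix satisfies `ρ ≤ I`, so `tr(ρ M(s)) ≤ tr M(s)`, which no longer involves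
`ρ`. Each diagonal entry of `M` is a lower-computable semimeasure on strings. By the Kraft–Chaitin
theorem (`exists_computer_of_requests`) some computer has, for every `s` with positive entry, a
program of length at most `-log₂` of that entry plus a constant
(`exists_computer_of_lowerComputable`). Optimality carries this over to `U`, and summing over the
`N` diagonal entries gives `b`. -/

namespace SemiPOVM

/-! ### Kraft's inequality -/

theorem uniquelyDecodable_of_prefixFree {α : Type*} {S : Set (List α)} (hnil : [] ∉ S)
    (hS : ∀ p ∈ S, ∀ q ∈ S, p <+: q → p = q) : InformationTheory.UniquelyDecodable S := by
  intro L₁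
  induction L₁ with
  | nil =>
    intro L₂ _ h₂ h
    cases L₂ with
    | nil => rfl
    | cons w L₂ =>
      have hw : w = [] := by
        have := h.symm
        simp only [List.flatten_nil, List.flatten_cons, List.append_eq_nil_iff] at this
        exact this.1
      exact absurd (hw ▸ h₂ w (by simp)) hnil
  | cons v L₁ ih =>
    intro L₂ h₁ h₂ h
    cases L₂ with
    | nil =>
      have hv : v = [] := by
        simp only [List.flatten_nil, List.flatten_cons, List.append_eq_nil_iff] at h
        exact h.1
      exact absurd (hv ▸ h₁ v (by simp)) hnil
    | cons w L₂ =>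
      simp only [List.flatten_cons] at h
      have hvw : v = w := by
        have hv : v <+: w ++ L₂.flatten := ⟨_, h⟩
        have hw : w <+: w ++ L₂.flatten := ⟨_, rfl⟩
        rcases List.prefix_or_prefix_of_prefix hv hw with h' | h'
        · exact hS v (h₁ v (by simp)) w (h₂ w (by simp)) h'
        · exact (hS w (h₂ w (by simp)) v (h₁ v (by simp)) h').symm
      subst hvw
      rw [ih L₂ (fun w hw => h₁ w (by simp [hw])) (fun w hw => h₂ w (by simp [hw]))
        (List.append_cancel_left h)]

theorem kraft_inequality {S : Finset (List Bool)}
    (hS : ∀ p ∈ S, ∀ q ∈ S, p <+: q → p = q) : ∑ p ∈ S, (2 : ℝ)⁻¹ ^ p.length ≤ 1 := by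
  -- A set containing the empty string is not uniquely decodable, so Kraft–McMillan does not apply
  -- to it; but prefix-freeness then leaves only that one string.
  by_cases hnil : [] ∈ S
  · have : S = {[]} := by
      ext p
      simp only [Finset.mem_singleton]
      exact ⟨fun hp => (hS [] hnil p hp List.nil_prefix).symm, fun hp => hp ▸ hnil⟩
    simp [this]
  · have := InformationTheory.kraft_mcmillan_inequality
      (uniquelyDecodable_of_prefixFree (S := (S : Set (List Bool))) (by simpa using hnil)
        (by simpa using hS))
    simpa using this

/-! ### Traces of products of positive semidefinite matrices -/

/-- In an eigenbasis of `B` the trace is the sum of the eigenvalues of `B` weighted by the diagonal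
entries of a conjugate of `A`, all nonnegative. -/
theorem trace_mul_nonneg {n : Type*} [Fintype n] {A B : Matrix n n ℂ}
    (hA : A.PosSemidef) (hB : B.PosSemidef) : 0 ≤ (A * B).trace := by
  classical
  rw [hB.1.spectral_theorem, Unitary.conjStarAlgAut_apply, ← Matrix.mul_assoc,
    Matrix.trace_mul_comm, ← Matrix.mul_assoc, ← Matrix.mul_assoc, Matrix.trace]
  refine Finset.sum_nonneg fun i _ => ?_
  rw [Matrix.diag_apply, Matrix.mul_diagonal]
  refine mul_nonneg ?_ (by simpa using hB.eigenvalues_nonneg i)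
  exact (hA.conjTranspose_mul_mul_same (hB.1.eigenvectorUnitary : Matrix n n ℂ)).diag_nonneg

/-- The eigenvalues are nonnegative with sum one, so none exceeds one. -/
theorem posSemidef_one_sub {n : Type*} [Fintype n] [DecidableEq n] {A : Matrix n n ℂ}
    (hA : A.PosSemidef) (htr : A.trace = 1) : (1 - A).PosSemidef := by
  have hle : ∀ i, hA.1.eigenvalues i ≤ 1 := by
    intro i
    have h := hA.1.trace_eq_sum_eigenvalues
    rw [htr] at h
    have h' : ∑ i, hA.1.eigenvalues i = 1 := by
      have := congrArg Complex.re h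
      simpa using this.symm
    rw [← h']
    exact Finset.single_le_sum (fun j _ => hA.eigenvalues_nonneg j) (Finset.mem_univ i)
  have h1 : 1 - A = Unitary.conjStarAlgAut ℂ _ hA.1.eigenvectorUnitary
      (Matrix.diagonal fun i => ((1 - hA.1.eigenvalues i : ℝ) : ℂ)) := by
    have : (Matrix.diagonal fun i => ((1 - hA.1.eigenvalues i : ℝ) : ℂ)) =
        1 - Matrix.diagonal (RCLike.ofReal ∘ hA.1.eigenvalues) := by
      rw [← Matrix.diagonal_one, Matrix.diagonal_sub]
      congr 1
      ext i
      simp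
    rw [this, map_sub, map_one, ← hA.1.spectral_theorem]
  rw [h1, Unitary.conjStarAlgAut_apply]
  refine Matrix.PosSemidef.mul_mul_conjTranspose_same (Matrix.PosSemidef.diagonal fun i => ?_) _
  exact Complex.zero_le_real.2 (sub_nonneg.2 (hle i))

theorem outcomeProb_nonneg {N : ℕ} {ρ A : Matrix (Fin N) (Fin N) ℂ}
    (hρ : ρ.PosSemidef) (hA : A.PosSemidef) : 0 ≤ outcomeProb ρ A :=
  (Complex.le_def.1 (trace_mul_nonneg hρ hA)).1

/-- This is where uniformity in `ρ` comes from: pair `A` with `1 - ρ`, which is positive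
semidefinite. -/
theorem outcomeProb_le_trace {N : ℕ} {ρ A : Matrix (Fin N) (Fin N) ℂ}
    (hρ : IsDensityMatrix ρ) (hA : A.PosSemidef) : outcomeProb ρ A ≤ A.trace.re := by
  have h := outcomeProb_nonneg (posSemidef_one_sub hρ.posSemidef hρ.trace_eq_one) hA
  simp only [outcomeProb, sub_mul, one_mul, Matrix.trace_sub, Complex.sub_re] at h
  exact sub_nonneg.1 h

theorem le_outcomeProb_of_posSemidef_sub_smul_one {N : ℕ} {ρ A : Matrix (Fin N) (Fin N) ℂ} {c : ℝ}
    (hρ : IsDensityMatrix ρ) (hA : (A - c • (1 : Matrix (Fin N) (Fin N) ℂ)).PosSemidef) :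
    c ≤ outcomeProb ρ A := by
  have h := outcomeProb_nonneg hρ.posSemidef hA
  simp only [outcomeProb, mul_sub, Matrix.mul_smul, mul_one, Matrix.trace_sub, Matrix.trace_smul,
    hρ.trace_eq_one, Complex.sub_re] at h
  simp only [Complex.real_smul, mul_one, Complex.ofReal_re, sub_nonneg] at h
  exact h

/-! ### Binary strings as dyadic intervals -/

/-- The natural number with binary expansion `p`, most significant digit first. -/
def binVal (p : List Bool) : ℕ := p.foldl (fun v b => 2 * v + b.toNat) 0

theorem binVal_concat (p : List Bool) (b : Bool) : binVal (p ++ [b]) = 2 * binVal p + b.toNat := by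
  simp [binVal]

theorem binVal_append (p q : List Bool) :
    binVal (p ++ q) = binVal p * 2 ^ q.length + binVal q := by
  induction q using List.reverseRecOn with
  | nil => simp [binVal]
  | append_singleton q b ih =>
    rw [← List.append_assoc, binVal_concat, binVal_concat, ih, List.length_append,
      List.length_singleton, pow_succ]
    ring

theorem binVal_lt (p : List Bool) : binVal p < 2 ^ p.length := by
  induction p using List.reverseRecOn with
  | nil => simp [binVal]
  | append_singleton p b ih =>
    rw [binVal_concat, List.length_append, List.length_singleton, pow_succ]
    have := Bool.toNat_le b
    omega

theorem exists_binVal_eq (L : ℕ) : ∀ m < 2 ^ L, ∃ p : List Bool, p.length = L ∧ binVal p = m := by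
  induction L with
  | zero => intro m hm; exact ⟨[], rfl, by simp [binVal]; omega⟩
  | succ L ih =>
    intro m hm
    obtain ⟨p, hp, hv⟩ := ih (m / 2) (by rw [pow_succ] at hm; omega)
    refine ⟨p ++ [m.bodd], by simp [hp], ?_⟩
    rw [binVal_concat, hv]
    have := Nat.bodd_add_div2 m
    rw [Nat.div2_val] at this
    rw [add_comm]
    exact this

theorem primrec_binVal : Primrec binVal :=
  Primrec.list_foldl Primrec.id (Primrec.const 0)
    ((Primrec.nat_add.comp (Primrec.nat_double.comp (Primrec.fst.comp Primrec.snd))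
      ((Primrec.dom_bool Bool.toNat).comp (Primrec.snd.comp Primrec.snd))).to₂)

/-- The left endpoint of the dyadic interval of reals whose binary expansion extends `p`. -/
noncomputable def leftEnd (p : List Bool) : ℝ := binVal p * (2 : ℝ)⁻¹ ^ p.length

/-- Appending `r` moves the left endpoint by `2^{-|p|}` times the fraction `binVal r / 2^{|r|}`,
which lies in `[0, 1)`. -/
theorem leftEnd_le_of_prefix {p q : List Bool} (h : p <+: q) :
    leftEnd p ≤ leftEnd q ∧ leftEnd q < leftEnd p + (2 : ℝ)⁻¹ ^ p.length := by
  obtain ⟨r, rfl⟩ := h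
  have hr : (binVal r : ℝ) < 2 ^ r.length := by exact_mod_cast binVal_lt r
  have key : leftEnd (p ++ r) =
      leftEnd p + (2 : ℝ)⁻¹ ^ p.length * (binVal r * (2 : ℝ)⁻¹ ^ r.length) := by
    have h2 : (2 : ℝ) ^ r.length * (2 : ℝ)⁻¹ ^ r.length = 1 := by
      rw [← mul_pow]; norm_num
    simp only [leftEnd, binVal_append, List.length_append, pow_add]
    push_cast
    linear_combination (binVal p : ℝ) * (2 : ℝ)⁻¹ ^ p.length * h2
  have hlt : (binVal r : ℝ) * (2 : ℝ)⁻¹ ^ r.length < 1 := by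
    rw [inv_pow, ← div_eq_mul_inv, div_lt_one (by positivity)]
    exact hr
  have hp : (0 : ℝ) < (2 : ℝ)⁻¹ ^ p.length := by positivity
  rw [key]
  refine ⟨le_add_of_nonneg_right (by positivity), ?_⟩
  have := mul_lt_mul_of_pos_left hlt hp
  linarith

/-! ### The Kraft–Chaitin theorem -/

theorem primrec_two_pow : Primrec fun n : ℕ => 2 ^ n :=
  (Primrec₂.unpaired'.1 Nat.Primrec.pow).comp (Primrec.const 2) Primrec.id

/-- The weight `2^{-n}` of a request for a program of length about `n`. -/
noncomputable def requestWeight : Option (ℕ × List Bool) → ℝ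
  | none => 0
  | some x => (2 : ℝ)⁻¹ ^ x.1

theorem requestWeight_nonneg (o : Option (ℕ × List Bool)) : 0 ≤ requestWeight o := by
  cases o <;> simp [requestWeight]

/-- A pair `(a, e)` stands for the dyadic rational `a / 2^e`; this adds to it the weight of a
request. -/
def allocStep (q : ℕ × ℕ) (o : Option (ℕ × List Bool)) : ℕ × ℕ :=
  o.elim q fun x => (q.1 * 2 ^ x.1 + 2 ^ q.2, q.2 + x.1)

/-- The sum of the weights of the first `k` requests. -/
def alloc (req : ℕ → Option (ℕ × List Bool)) (k : ℕ) : ℕ × ℕ :=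
  Nat.rec (0, 0) (fun k q => allocStep q (req k)) k

/-- The numerator of the least multiple of `2^{-(n+1)}` that is at least `a / 2^e`. -/
def slot (q : ℕ × ℕ) (n : ℕ) : ℕ := (q.1 * 2 ^ (n + 1) + (2 ^ q.2 - 1)) / 2 ^ q.2

theorem alloc_eq_sum (req : ℕ → Option (ℕ × List Bool)) (k : ℕ) :
    ((alloc req k).1 : ℝ) * (2 : ℝ)⁻¹ ^ (alloc req k).2 =
      ∑ j ∈ Finset.range k, requestWeight (req j) := by
  induction k with
  | zero => simp [alloc]
  | succ k ih =>
    rw [Finset.sum_range_succ, ← ih]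
    change ((allocStep (alloc req k) (req k)).1 : ℝ) * _ ^ (allocStep (alloc req k) (req k)).2 = _
    cases req k with
    | none => simp [allocStep, requestWeight]
    | some x =>
      simp only [allocStep, Option.elim_some, requestWeight, pow_add]
      push_cast
      simp only [inv_pow]
      field_simp

/-- Rounding up to a multiple of `2^{-(n+1)}` costs less than `2^{-(n+1)}`, so an aligned dyadic
interval of half the length `2^{-n}` still fits in the space reserved for the request. This is the
bit that is lost. -/
theorem slot_bounds (q : ℕ × ℕ) (n : ℕ) :
    (q.1 : ℝ) * (2 : ℝ)⁻¹ ^ q.2 ≤ slot q n * (2 : ℝ)⁻¹ ^ (n + 1) ∧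
      (slot q n : ℝ) * (2 : ℝ)⁻¹ ^ (n + 1) + (2 : ℝ)⁻¹ ^ (n + 1) <
        (q.1 : ℝ) * (2 : ℝ)⁻¹ ^ q.2 + (2 : ℝ)⁻¹ ^ n := by
  have hpos : 0 < 2 ^ q.2 := by positivity
  have h1 : q.1 * 2 ^ (n + 1) ≤ slot q n * 2 ^ q.2 := by
    have := Nat.lt_div_mul_add (a := q.1 * 2 ^ (n + 1) + (2 ^ q.2 - 1)) hpos
    rw [slot]
    omega
  have h2 : slot q n * 2 ^ q.2 < q.1 * 2 ^ (n + 1) + 2 ^ q.2 := by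
    have := Nat.div_mul_le_self (q.1 * 2 ^ (n + 1) + (2 ^ q.2 - 1)) (2 ^ q.2)
    rw [slot]
    omega
  have h1' : (q.1 : ℝ) * 2 ^ (n + 1) ≤ slot q n * 2 ^ q.2 := by exact_mod_cast h1
  have h2' : (slot q n : ℝ) * 2 ^ q.2 < q.1 * 2 ^ (n + 1) + 2 ^ q.2 := by exact_mod_cast h2
  simp only [inv_pow, ← div_eq_mul_inv]
  constructor
  · rw [div_le_div_iff₀ (by positivity) (by positivity)]
    exact h1'
  · have : (slot q n : ℝ) / 2 ^ (n + 1) < q.1 / 2 ^ q.2 + (2 ^ (n + 1))⁻¹ := by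
      rw [div_add' _ _ _ (by positivity), div_lt_div_iff₀ (by positivity) (by positivity), add_mul]
      have : ((2 : ℝ) ^ (n + 1))⁻¹ * 2 ^ q.2 * 2 ^ (n + 1) = 2 ^ q.2 := by field_simp
      linarith
    have h3 : ((2 : ℝ) ^ n)⁻¹ = 2 * (2 ^ (n + 1))⁻¹ := by rw [pow_succ]; field_simp
    linarith

theorem primrec_allocStep : Primrec₂ allocStep := by
  refine (Primrec.option_casesOn Primrec.snd Primrec.fst
    (g := fun (a : (ℕ × ℕ) × Option (ℕ × List Bool)) (x : ℕ × List Bool) =>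
      (a.1.1 * 2 ^ x.1 + 2 ^ a.1.2, a.1.2 + x.1)) ?_).to₂.of_eq ?_
  · have hq1 : Primrec fun a : ((ℕ × ℕ) × Option (ℕ × List Bool)) × (ℕ × List Bool) => a.1.1.1 :=
      Primrec.fst.comp (Primrec.fst.comp Primrec.fst)
    have hq2 : Primrec fun a : ((ℕ × ℕ) × Option (ℕ × List Bool)) × (ℕ × List Bool) => a.1.1.2 :=
      Primrec.snd.comp (Primrec.fst.comp Primrec.fst)
    have hn : Primrec fun a : ((ℕ × ℕ) × Option (ℕ × List Bool)) × (ℕ × List Bool) => a.2.1 :=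
      Primrec.fst.comp Primrec.snd
    exact ((Primrec.nat_add.comp (Primrec.nat_mul.comp hq1 (primrec_two_pow.comp hn))
      (primrec_two_pow.comp hq2)).pair (Primrec.nat_add.comp hq2 hn)).to₂
  · rintro q (_ | x) <;> rfl

theorem primrec_slot : Primrec₂ slot := by
  have hq1 : Primrec fun a : (ℕ × ℕ) × ℕ => a.1.1 := Primrec.fst.comp Primrec.fst
  have hq2 : Primrec fun a : (ℕ × ℕ) × ℕ => 2 ^ a.1.2 :=
    primrec_two_pow.comp (Primrec.snd.comp Primrec.fst)
  have hn : Primrec fun a : (ℕ × ℕ) × ℕ => 2 ^ (a.2 + 1) :=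
    primrec_two_pow.comp (Primrec.succ.comp Primrec.snd)
  exact (Primrec.nat_div.comp (Primrec.nat_add.comp (Primrec.nat_mul.comp hq1 hn)
    (Primrec.nat_sub.comp hq2 (Primrec.const 1))) hq2).to₂

theorem computable_alloc {req : ℕ → Option (ℕ × List Bool)} (hreq : Computable req) :
    Computable (alloc req) :=
  Computable.nat_rec (h := fun _ (a : ℕ × ℕ × ℕ) => allocStep a.2 (req a.1))
    Computable.id (Computable.const (0, 0))
    ((primrec_allocStep.to_comp.comp (Computable.snd.comp Computable.snd)
      (hreq.comp (Computable.fst.comp Computable.snd))).to₂)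

/-- The answer to the program `p` provided by the `k`-th request. -/
def respond (req : ℕ → Option (ℕ × List Bool)) (p : List Bool) (k : ℕ) : Option (List Bool) :=
  (req k).bind fun x =>
    bif p.length == x.1 + 1 && binVal p == slot (alloc req k) x.1 then some x.2 else none

theorem computable_respond {req : ℕ → Option (ℕ × List Bool)} (hreq : Computable req) :
    Computable₂ (respond req) := by
  refine Computable.option_bind (hreq.comp Computable.snd)
    (g := fun (a : List Bool × ℕ) (x : ℕ × List Bool) =>
      bif a.1.length == x.1 + 1 && binVal a.1 == slot (alloc req a.2) x.1
      then some x.2 else none) ?_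
  have hp : Computable fun a : (List Bool × ℕ) × (ℕ × List Bool) => a.1.1 :=
    Computable.fst.comp Computable.fst
  have hn : Computable fun a : (List Bool × ℕ) × (ℕ × List Bool) => a.2.1 :=
    Computable.fst.comp Computable.snd
  have hq : Computable fun a : (List Bool × ℕ) × (ℕ × List Bool) => alloc req a.1.2 :=
    (computable_alloc hreq).comp (Computable.snd.comp Computable.fst)
  refine Computable.cond (Primrec.and.to_comp.comp ?_ ?_)
    (Computable.option_some.comp (Computable.snd.comp Computable.snd)) (Computable.const none)
  · exact Primrec.beq.to_comp.comp (Computable.list_length.comp hp) (Computable.succ.comp hn)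
  · exact Primrec.beq.to_comp.comp (primrec_binVal.to_comp.comp hp)
      (primrec_slot.to_comp.comp hq hn)

theorem mem_respond {req : ℕ → Option (ℕ × List Bool)} {p s : List Bool} {k : ℕ} :
    s ∈ respond req p k ↔
      ∃ n, req k = some (n, s) ∧ p.length = n + 1 ∧ binVal p = slot (alloc req k) n := by
  unfold respond
  cases h : req k with
  | none => simp
  | some x =>
    obtain ⟨n, t⟩ := x
    simp only [Option.bind_some, Bool.cond_eq_ite, Bool.and_eq_true, beq_iff_eq, Option.mem_def,
      Option.some.injEq, Prod.mk.injEq]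
    constructor
    · intro h
      split_ifs at h with h'
      exact ⟨n, ⟨rfl, by simpa using h⟩, h'⟩
    · rintro ⟨m, ⟨rfl, rfl⟩, h'⟩
      rw [if_pos h']

theorem leftEnd_bounds_of_mem_respond {req : ℕ → Option (ℕ × List Bool)} {p s : List Bool} {k : ℕ}
    (h : s ∈ respond req p k) :
    ∑ j ∈ Finset.range k, requestWeight (req j) ≤ leftEnd p ∧
      leftEnd p + (2 : ℝ)⁻¹ ^ p.length ≤ ∑ j ∈ Finset.range (k + 1), requestWeight (req j) := by
  obtain ⟨n, hk, hlen, hval⟩ := mem_respond.1 h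
  rw [Finset.sum_range_succ, ← alloc_eq_sum, hk, leftEnd, hlen, hval]
  exact ⟨(slot_bounds _ n).1, (slot_bounds _ n).2.le⟩

/-- A prefix relation places the left endpoint of `q` in the interval of `p`, whereas different
requests own non-overlapping intervals. The case `p = q` shows that a program answers at most one
request. -/
theorem respond_index_unique {req : ℕ → Option (ℕ × List Bool)} {p q s t : List Bool} {k l : ℕ}
    (hp : s ∈ respond req p k) (hq : t ∈ respond req q l) (hpq : p <+: q) : k = l := by
  have hmono : Monotone fun k => ∑ j ∈ Finset.range k, requestWeight (req j) :=
    monotone_nat_of_le_succ fun k => by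
      rw [Finset.sum_range_succ]
      exact le_add_of_nonneg_right (requestWeight_nonneg _)
  have h1 := leftEnd_bounds_of_mem_respond hp
  have h2 := leftEnd_bounds_of_mem_respond hq
  have h3 := leftEnd_le_of_prefix hpq
  have hqpos : (0 : ℝ) < (2 : ℝ)⁻¹ ^ q.length := by positivity
  rcases lt_trichotomy k l with h | h | h
  · have := hmono (show k + 1 ≤ l from h)
    simp only at this
    linarith
  · exact h
  · have := hmono (show l + 1 ≤ k from h)
    simp only at this
    linarith

/-- **Kraft–Chaitin theorem**, losing one bit: a recursive list of requests of total weight at most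
one is served by a computer. -/
theorem exists_computer_of_requests {req : ℕ → Option (ℕ × List Bool)} (hreq : Computable req)
    (hsum : ∀ k, ∑ j ∈ Finset.range k, requestWeight (req j) ≤ 1) :
    ∃ C : List Bool →. List Bool, IsComputer C ∧
      ∀ k n s, req k = some (n, s) → ∃ p : List Bool, s ∈ C p ∧ p.length = n + 1 := by
  refine ⟨fun p => Nat.rfindOpt (respond req p),
    ⟨Partrec.rfindOpt (computable_respond hreq), ?_⟩, ?_⟩
  · intro p q hp hq hpq
    obtain ⟨k, s, hk⟩ := Nat.rfindOpt_dom.1 hp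
    obtain ⟨l, t, hl⟩ := Nat.rfindOpt_dom.1 hq
    have hkl := respond_index_unique hk hl hpq
    subst hkl
    obtain ⟨n, hn, hlen, -⟩ := mem_respond.1 hk
    obtain ⟨m, hm, hlen', -⟩ := mem_respond.1 hl
    have hnm : n = m := by
      have := hn.symm.trans hm
      simp only [Option.some.injEq, Prod.mk.injEq] at this
      exact this.1
    -- Both programs serve the same request, hence have the same length.
    exact hpq.eq_of_length (by omega)
  · intro k n s hk
    -- The slot ends before the partial sum of weights up to and including request `k`, which is at
    -- most one; so its numerator has at most `n + 1` binary digits.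
    have hlt : slot (alloc req k) n < 2 ^ (n + 1) := by
      have h1 := (slot_bounds (alloc req k) n).2
      have h2 := hsum (k + 1)
      rw [Finset.sum_range_succ, ← alloc_eq_sum, hk] at h2
      change _ + (2 : ℝ)⁻¹ ^ n ≤ 1 at h2
      have h3 : (slot (alloc req k) n : ℝ) * (2 : ℝ)⁻¹ ^ (n + 1) < 1 := by
        have : (0 : ℝ) < (2 : ℝ)⁻¹ ^ (n + 1) := by positivity
        linarith
      rw [inv_pow, ← div_eq_mul_inv, div_lt_one (by positivity)] at h3
      exact_mod_cast h3
    obtain ⟨p, hlen, hval⟩ := exists_binVal_eq _ _ hlt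
    have hmem : s ∈ respond req p k := mem_respond.2 ⟨n, hk, hlen, hval⟩
    refine ⟨p, ?_, hlen⟩
    have hdom := Nat.rfindOpt_dom.2 ⟨k, s, hmem⟩
    -- The search could a priori stop at another request; uniqueness of the index excludes this.
    obtain ⟨l, hl⟩ := Nat.rfindOpt_spec (Part.get_mem hdom)
    have hkl := respond_index_unique hmem hl List.prefix_rfl
    subst hkl
    have := Option.mem_unique hmem hl
    rw [this]
    exact Part.get_mem hdom

/-! ### Lower-computable semimeasures are dominated by computers -/

/-- For `c = (x, y, d)`, whether `(x - y) / (d + 1)` exceeds `2 / 2^n`. -/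
def exceeds (c : ℕ × ℕ × ℕ) (n : ℕ) : Bool :=
  decide (2 * (c.2.2 + 1) + c.2.1 * 2 ^ n < c.1 * 2 ^ n)

theorem primrec_exceeds : Primrec₂ exceeds := by
  have hx : Primrec fun a : (ℕ × ℕ × ℕ) × ℕ => a.1.1 := Primrec.fst.comp Primrec.fst
  have hy : Primrec fun a : (ℕ × ℕ × ℕ) × ℕ => a.1.2.1 :=
    Primrec.fst.comp (Primrec.snd.comp Primrec.fst)
  have hd : Primrec fun a : (ℕ × ℕ × ℕ) × ℕ => a.1.2.2 :=
    Primrec.snd.comp (Primrec.snd.comp Primrec.fst)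
  have hn : Primrec fun a : (ℕ × ℕ × ℕ) × ℕ => 2 ^ a.2 := primrec_two_pow.comp Primrec.snd
  exact (PrimrecRel.comp Primrec.nat_lt
    (Primrec.nat_add.comp (Primrec.nat_double.comp (Primrec.succ.comp hd))
      (Primrec.nat_mul.comp hy hn)) (Primrec.nat_mul.comp hx hn)).decide

theorem exceeds_iff (c : ℕ × ℕ × ℕ) (n : ℕ) : exceeds c n = true ↔
    2 * (2 : ℝ)⁻¹ ^ n <
      (((((c.1 : ℚ) - (c.2.1 : ℚ)) / ((c.2.2 : ℚ) + 1) : ℚ)) : ℝ) := by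
  push_cast
  rw [exceeds, decide_eq_true_iff, inv_pow, ← div_eq_mul_inv,
    div_lt_div_iff₀ (by positivity) (by positivity), sub_mul, lt_sub_iff_add_lt]
  exact_mod_cast Iff.rfl

/-- Whether `t` is the first stage at which the approximation at `s` exceeds `2 / 2^n`. -/
def firstExceeds (code : ℕ × List Bool → ℕ × ℕ × ℕ) (x : ℕ × ℕ × List Bool) : Bool :=
  exceeds (code (x.1, x.2.2)) x.2.1 &&
    Nat.rec true (fun t b => b && !exceeds (code (t, x.2.2)) x.2.1) x.1

theorem firstExceeds_iff (code : ℕ × List Bool → ℕ × ℕ × ℕ) (t n : ℕ) (s : List Bool) :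
    firstExceeds code (t, n, s) = true ↔
      exceeds (code (t, s)) n = true ∧ ∀ u < t, exceeds (code (u, s)) n = false := by
  have key : ∀ t : ℕ,
      (Nat.rec true (fun t b => b && !exceeds (code (t, s)) n) t : Bool) = true ↔
        ∀ u < t, exceeds (code (u, s)) n = false := by
    intro t
    induction t with
    | zero => simp
    | succ t ih =>
      rw [Nat.forall_lt_succ_right, ← ih]
      simp
  rw [firstExceeds, Bool.and_eq_true, key]

theorem computable_firstExceeds {code : ℕ × List Bool → ℕ × ℕ × ℕ} (hcode : Computable code) :
    Computable (firstExceeds code) := by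
  have hs : Computable fun x : ℕ × ℕ × List Bool => x.2.2 := Computable.snd.comp Computable.snd
  have hn : Computable fun x : ℕ × ℕ × List Bool => x.2.1 := Computable.fst.comp Computable.snd
  refine Primrec.and.to_comp.comp
    (primrec_exceeds.to_comp.comp (hcode.comp (Computable.fst.pair hs)) hn)
    (Computable.nat_rec (h := fun (x : ℕ × ℕ × List Bool) (y : ℕ × Bool) =>
      y.2 && !exceeds (code (y.1, x.2.2)) x.2.1) Computable.fst (Computable.const true) ?_)
  exact (Primrec.and.to_comp.comp (Computable.snd.comp Computable.snd)
    (Primrec.not.to_comp.comp (primrec_exceeds.to_comp.comp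
      (hcode.comp ((Computable.fst.comp Computable.snd).pair (hs.comp Computable.fst)))
      (hn.comp Computable.fst)))).to₂

/-- The request, for each `n` and `s`, of a program for `s` of length about `n`, issued when the
approximation at `s` first exceeds `2 / 2^n`. -/
def thresholdRequest (code : ℕ × List Bool → ℕ × ℕ × ℕ) (k : ℕ) : Option (ℕ × List Bool) :=
  (Encodable.decode₂ (ℕ × ℕ × List Bool) k).bind fun x =>
    bif firstExceeds code x then some x.2 else none

theorem computable_thresholdRequest {code : ℕ × List Bool → ℕ × ℕ × ℕ} (hcode : Computable code) :
    Computable (thresholdRequest code) :=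
  Computable.option_bind Primrec.decode₂.to_comp
    (Computable.cond ((computable_firstExceeds hcode).comp Computable.snd)
      (Computable.option_some.comp (Computable.snd.comp Computable.snd))
      (Computable.const none)).to₂

theorem thresholdRequest_encode (code : ℕ × List Bool → ℕ × ℕ × ℕ) (x : ℕ × ℕ × List Bool) :
    thresholdRequest code (Encodable.encode x) =
      bif firstExceeds code x then some x.2 else none := by
  simp [thresholdRequest]

theorem tsum_ite_le_two_inv_pow (m : ℕ) :
    ∑' n : ℕ, (if m ≤ n then (2 : ENNReal)⁻¹ ^ n else 0) = 2 * (2 : ENNReal)⁻¹ ^ m := by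
  have h : ∑' i : ℕ, (if m ≤ m + i then (2 : ENNReal)⁻¹ ^ (m + i) else 0) =
      ∑' n : ℕ, (if m ≤ n then (2 : ENNReal)⁻¹ ^ n else 0) := by
    refine (add_right_injective m).tsum_eq
      (f := fun n => if m ≤ n then (2 : ENNReal)⁻¹ ^ n else 0) fun n hn => ?_
    have hmn : m ≤ n := by
      by_contra hmn
      simp [hmn] at hn
    exact ⟨n - m, by simp; omega⟩
  rw [← h]
  simp [pow_add, ENNReal.tsum_mul_left, mul_comm]

/-- The admissible `n` start at a least `m`, and the geometric tail from `m` is `2 * 2^{-m} < r`.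
The factor 2 in the threshold is there to absorb this tail. -/
theorem tsum_threshold_le (r : ℝ) :
    ∑' n : ℕ, (if 2 * (2 : ℝ)⁻¹ ^ n < r then (2 : ENNReal)⁻¹ ^ n else 0) ≤ ENNReal.ofReal r := by
  by_cases h : ∃ n : ℕ, 2 * (2 : ℝ)⁻¹ ^ n < r
  · classical
    have hfind := Nat.find_spec h
    have h2 : ENNReal.ofReal (2 * (2 : ℝ)⁻¹ ^ Nat.find h) = 2 * (2 : ENNReal)⁻¹ ^ Nat.find h := by
      rw [ENNReal.ofReal_mul (by norm_num), ENNReal.ofReal_pow (by norm_num),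
        ENNReal.ofReal_inv_of_pos (by norm_num)]
      simp
    calc _ ≤ ∑' n : ℕ, (if Nat.find h ≤ n then (2 : ENNReal)⁻¹ ^ n else 0) := by
          refine ENNReal.tsum_le_tsum fun n => ?_
          split_ifs with h₁ h₂
          · exact le_rfl
          · exact absurd (Nat.find_min' h h₁) h₂
          · exact zero_le
          · exact le_rfl
      _ = 2 * (2 : ENNReal)⁻¹ ^ Nat.find h := tsum_ite_le_two_inv_pow _
      _ ≤ ENNReal.ofReal r := by
          rw [← h2]
          exact ENNReal.ofReal_le_ofReal hfind.le
  · push Not at h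
    rw [ENNReal.tsum_eq_zero.2 fun n => if_neg (not_lt.2 (h n))]
    exact zero_le

/-- Only a first crossing issues a request, so each pair `(n, s)` is charged at most once, and only
if `2 * 2^{-n} < r s`. Summing over `n` costs at most `r s` for each `s`. -/
theorem sum_thresholdRequest_le {code : ℕ × List Bool → ℕ × ℕ × ℕ} {r : List Bool → ℝ}
    (hr : ∀ s, 0 ≤ r s) (hsum : Summable r) (hone : ∑' s, r s ≤ 1)
    (hle : ∀ t n s, exceeds (code (t, s)) n = true → 2 * (2 : ℝ)⁻¹ ^ n < r s) (k : ℕ) :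
    ∑ j ∈ Finset.range k, requestWeight (thresholdRequest code j) ≤ 1 := by
  -- In `ENNReal` the sums over stages, thresholds and strings can be interchanged freely.
  let w : ℕ → ENNReal := fun j => ENNReal.ofReal (requestWeight (thresholdRequest code j))
  have hstage : ∀ (n : ℕ) (s : List Bool), ∑' t : ℕ, w (Encodable.encode (t, n, s)) ≤
      if 2 * (2 : ℝ)⁻¹ ^ n < r s then (2 : ENNReal)⁻¹ ^ n else 0 := by
    intro n s
    have hzero : ∀ t, firstExceeds code (t, n, s) = false → w (Encodable.encode (t, n, s)) = 0 := by
      intro t ht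
      simp only [w, thresholdRequest_encode, ht, cond_false, requestWeight, ENNReal.ofReal_zero]
    by_cases h : ∃ t, firstExceeds code (t, n, s) = true
    · obtain ⟨t, ht⟩ := h
      have ht' := (firstExceeds_iff _ _ _ _).1 ht
      rw [if_pos (hle t n s ht'.1), tsum_eq_single t]
      · simp only [w, thresholdRequest_encode, ht, cond_true, requestWeight]
        rw [ENNReal.ofReal_pow (by norm_num), ENNReal.ofReal_inv_of_pos (by norm_num)]
        simp
      · intro u hu
        refine hzero u (Bool.eq_false_iff.2 fun hu' => ?_)
        have hu' := (firstExceeds_iff _ _ _ _).1 hu'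
        rcases lt_or_gt_of_ne hu with h | h
        · exact Bool.false_ne_true ((ht'.2 u h).symm.trans hu'.1)
        · exact Bool.false_ne_true ((hu'.2 t h).symm.trans ht'.1)
    · push Not at h
      rw [ENNReal.tsum_eq_zero.2 fun t => hzero t (by simpa using h t)]
      exact zero_le
  have htotal : ∑' j, w j ≤ 1 := by
    calc ∑' j, w j = ∑' x : ℕ × ℕ × List Bool, w (Encodable.encode x) := by
          -- `decode₂` accepts only genuine codes, so each triple is met at exactly one index and
          -- all other indices have weight zero.
          refine (Encodable.encode_injective.tsum_eq fun j hj => ?_).symm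
          by_contra hj'
          refine hj ?_
          have : Encodable.decode₂ (ℕ × ℕ × List Bool) j = none := by
            rw [Option.eq_none_iff_forall_not_mem]
            intro x hx
            exact hj' ⟨x, Encodable.mem_decode₂.1 hx⟩
          simp [w, thresholdRequest, this, requestWeight]
      _ = ∑' (s : List Bool) (n : ℕ) (t : ℕ), w (Encodable.encode (t, n, s)) := by
          rw [ENNReal.tsum_prod', ENNReal.tsum_comm, ENNReal.tsum_prod', ENNReal.tsum_comm]
      _ ≤ ∑' s, ENNReal.ofReal (r s) :=
          ENNReal.tsum_le_tsum fun s =>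
            (ENNReal.tsum_le_tsum fun n => hstage n s).trans (tsum_threshold_le (r s))
      _ = ENNReal.ofReal (∑' s, r s) := (ENNReal.ofReal_tsum_of_nonneg hr hsum).symm
      _ ≤ 1 := ENNReal.ofReal_le_one.2 hone
  rw [← ENNReal.ofReal_le_one, ENNReal.ofReal_sum_of_nonneg fun _ _ => requestWeight_nonneg _]
  exact (ENNReal.sum_le_tsum _).trans htotal

/-- For the least `n` with `2 * 2^{-n} < r s`, minimality gives `r s ≤ 4 * 2^{-n}`. Since the
approximations converge to `r s`, this threshold is eventually crossed, and the program granted has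
length `n + 1`; hence the constant 8. The approximations need not be monotone. -/
theorem exists_computer_of_lowerComputable {a : ℕ × List Bool → ℚ} (ha : IsRecursiveRat a)
    {r : List Bool → ℝ} (hr : ∀ s, 0 ≤ r s) (hsum : Summable r) (hone : ∑' s, r s ≤ 1)
    (hle : ∀ t s, (a (t, s) : ℝ) ≤ r s)
    (hlim : ∀ s, Filter.Tendsto (fun t => (a (t, s) : ℝ)) Filter.atTop (nhds (r s))) :
    ∃ C : List Bool →. List Bool, IsComputer C ∧
      ∀ s, 0 < r s → ∃ p : List Bool, s ∈ C p ∧ r s ≤ 8 * (2 : ℝ)⁻¹ ^ p.length := by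
  classical
  obtain ⟨code, hcode, hval⟩ := ha
  have hex : ∀ t n s, exceeds (code (t, s)) n = true ↔ 2 * (2 : ℝ)⁻¹ ^ n < a (t, s) := by
    intro t n s
    rw [exceeds_iff, hval]
  obtain ⟨C, hC, hprog⟩ := exists_computer_of_requests (computable_thresholdRequest hcode)
    (sum_thresholdRequest_le hr hsum hone fun t n s h => ((hex t n s).1 h).trans_le (hle t s))
  refine ⟨C, hC, fun s hs => ?_⟩
  have hn : ∃ n : ℕ, 2 * (2 : ℝ)⁻¹ ^ n < r s := by
    obtain ⟨n, hn⟩ := exists_pow_lt_of_lt_one (half_pos hs) (show (2 : ℝ)⁻¹ < 1 by norm_num)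
    exact ⟨n, by linarith⟩
  have hspec := Nat.find_spec hn
  have hle4 : r s ≤ 4 * (2 : ℝ)⁻¹ ^ Nat.find hn := by
    -- When the least `n` is `0` there is no previous threshold to compare with; `r s ≤ 1` serves
    -- instead.
    rcases Nat.eq_zero_or_pos (Nat.find hn) with h0 | h0
    · rw [h0] at hspec ⊢
      have : r s ≤ 1 := (hsum.le_tsum s fun t _ => hr t).trans hone
      norm_num at hspec ⊢
      linarith
    · have := Nat.find_min hn (Nat.sub_lt h0 one_pos)
      rw [not_lt] at this
      have h2 : (2 : ℝ)⁻¹ ^ (Nat.find hn - 1) = 2 * (2 : ℝ)⁻¹ ^ Nat.find hn := by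
        conv_rhs => rw [← Nat.sub_add_cancel h0, pow_succ]
        ring
      linarith
  have ht : ∃ t, exceeds (code (t, s)) (Nat.find hn) = true := by
    obtain ⟨t, ht⟩ := ((hlim s).eventually (lt_mem_nhds hspec)).exists
    exact ⟨t, (hex _ _ _).2 ht⟩
  have hfirst : firstExceeds code (Nat.find ht, Nat.find hn, s) = true :=
    (firstExceeds_iff _ _ _ _).2
      ⟨Nat.find_spec ht, fun u hu => Bool.eq_false_iff.2 (Nat.find_min ht hu)⟩
  obtain ⟨p, hp, hlen⟩ := hprog (Encodable.encode (Nat.find ht, Nat.find hn, s)) (Nat.find hn) s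
    (by rw [thresholdRequest_encode, hfirst]; rfl)
  refine ⟨p, hp, ?_⟩
  rw [hlen, pow_succ]
  linarith

/-! ### Algorithmic probability as a lower-computable semi-POVM -/

theorem algProb_eq_tsum_indicator (U : List Bool →. List Bool) (s : List Bool) :
    algProb U s = ∑' p, {p | s ∈ U p}.indicator (fun p => (2 : ENNReal)⁻¹ ^ p.length) p :=
  tsum_subtype {p | s ∈ U p} fun p => (2 : ENNReal)⁻¹ ^ p.length

theorem tsum_dom_le_one {U : List Bool →. List Bool} (hU : IsComputer U) :
    ∑' p, {p | (U p).Dom}.indicator (fun p => (2 : ENNReal)⁻¹ ^ p.length) p ≤ 1 := by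
  classical
  rw [ENNReal.tsum_eq_iSup_sum]
  refine iSup_le fun S => ?_
  have h := kraft_inequality (S := S.filter fun p => (U p).Dom) fun p hp q hq hpq =>
    hU.prefixFree p q (Finset.mem_filter.1 hp).2 (Finset.mem_filter.1 hq).2 hpq
  rw [← ENNReal.ofReal_le_one, ENNReal.ofReal_sum_of_nonneg fun _ _ => by positivity] at h
  refine le_of_eq_of_le ?_ h
  rw [Finset.sum_filter]
  refine Finset.sum_congr rfl fun p _ => ?_
  rw [ENNReal.ofReal_pow (by norm_num), ENNReal.ofReal_inv_of_pos (by norm_num),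
    ENNReal.ofReal_ofNat]
  by_cases hp : (U p).Dom <;> simp [hp]

/-- After interchanging the sums, each halting program counts once, for its unique output. -/
theorem tsum_algProb_le_one {U : List Bool →. List Bool} (hU : IsComputer U) :
    ∑' s, algProb U s ≤ 1 := by
  simp only [algProb_eq_tsum_indicator]
  rw [ENNReal.tsum_comm]
  refine le_trans (ENNReal.tsum_le_tsum fun p => ?_) (tsum_dom_le_one hU)
  by_cases hp : (U p).Dom
  · rw [Set.indicator_of_mem (show p ∈ {p | (U p).Dom} from hp), tsum_eq_single ((U p).get hp)]
    · exact Set.indicator_le_self' (fun _ _ => zero_le) p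
    · intro s hs
      have : p ∉ {p | s ∈ U p} := fun h => hs (Part.mem_unique h (Part.get_mem hp))
      exact Set.indicator_of_notMem this _
  · have : ∀ s, p ∉ {p | s ∈ U p} := fun s h => hp (Part.dom_iff_mem.2 ⟨s, h⟩)
    rw [ENNReal.tsum_eq_zero.2 fun s => Set.indicator_of_notMem (this s) _]
    exact zero_le

theorem algProb_ne_top {U : List Bool →. List Bool} (hU : IsComputer U) (s : List Bool) :
    algProb U s ≠ ⊤ :=
  ne_top_of_le_ne_top ENNReal.one_ne_top ((ENNReal.le_tsum s).trans (tsum_algProb_le_one hU))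

theorem summable_algProb {U : List Bool →. List Bool} (hU : IsComputer U) :
    Summable fun s => (algProb U s).toReal :=
  ENNReal.summable_toReal (ne_top_of_le_ne_top ENNReal.one_ne_top (tsum_algProb_le_one hU))

theorem tsum_toReal_algProb_le_one {U : List Bool →. List Bool} (hU : IsComputer U) :
    ∑' s, (algProb U s).toReal ≤ 1 := by
  rw [← ENNReal.tsum_toReal_eq (algProb_ne_top hU)]
  exact ENNReal.toReal_le_of_le_ofReal zero_le_one (by simpa using tsum_algProb_le_one hU)

theorem hasSum_algProb {U : List Bool →. List Bool} (hU : IsComputer U) (s : List Bool) :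
    HasSum ({p | s ∈ U p}.indicator fun p => (2 : ℝ)⁻¹ ^ p.length) (algProb U s).toReal := by
  have h := ENNReal.hasSum_toReal
    (f := {p | s ∈ U p}.indicator fun p => (2 : ENNReal)⁻¹ ^ p.length)
    (by rw [← algProb_eq_tsum_indicator]; exact algProb_ne_top hU s)
  rw [← ENNReal.tsum_toReal_eq, ← algProb_eq_tsum_indicator] at h
  · convert h using 1
    ext p
    by_cases hp : s ∈ U p <;> simp [hp]
  · intro p
    by_cases hp : s ∈ U p <;> simp [hp]

theorem two_inv_pow_le_algProb {U : List Bool →. List Bool} (hU : IsComputer U) {p s : List Bool}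
    (h : s ∈ U p) : (2 : ℝ)⁻¹ ^ p.length ≤ (algProb U s).toReal := by
  have := le_hasSum (hasSum_algProb hU s) p fun q _ =>
    Set.indicator_nonneg (fun _ _ => by positivity) q
  rwa [Set.indicator_of_mem (show p ∈ {p | s ∈ U p} from h)] at this

open Nat.Partrec (Code)

/-- `2^n` times the contribution to the algorithmic probability of `s` of the program with code `i`,
if it is found within `n` steps to be a program for `s` of length at most `n`. -/
def stageTerm (c : Code) (n : ℕ) (s : List Bool) (i : ℕ) : ℕ :=
  (Encodable.decode₂ (List Bool) i).elim 0 fun p =>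
    bif decide (p.length ≤ n) && decide (c.evaln n i = some (Encodable.encode s))
    then 2 ^ (n - p.length) else 0

/-- `2^n` times the part of the algorithmic probability of `s` that is found within `n` steps. -/
def stageSum (c : Code) (n : ℕ) (s : List Bool) : ℕ :=
  Nat.rec 0 (fun i b => b + stageTerm c n s i) n

theorem stageSum_eq_sum (c : Code) (n : ℕ) (s : List Bool) :
    stageSum c n s = ∑ i ∈ Finset.range n, stageTerm c n s i := by
  have : ∀ m : ℕ, (Nat.rec 0 (fun i b => b + stageTerm c n s i) m : ℕ) =
      ∑ i ∈ Finset.range m, stageTerm c n s i := by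
    intro m
    induction m with
    | zero => rfl
    | succ m ih => rw [Finset.sum_range_succ, ← ih]
  exact this n

theorem primrec_stageTerm (c : Code) :
    Primrec fun x : (ℕ × List Bool) × ℕ => stageTerm c x.1.1 x.1.2 x.2 := by
  refine (Primrec.option_casesOn (Primrec.decode₂.comp Primrec.snd) (Primrec.const 0)
    (g := fun (x : (ℕ × List Bool) × ℕ) (p : List Bool) =>
      bif decide (p.length ≤ x.1.1) && decide (c.evaln x.1.1 x.2 = some (Encodable.encode x.1.2))
      then 2 ^ (x.1.1 - p.length) else 0) ?_).of_eq ?_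
  · have hn : Primrec fun y : ((ℕ × List Bool) × ℕ) × List Bool => y.1.1.1 :=
      Primrec.fst.comp (Primrec.fst.comp Primrec.fst)
    have hs : Primrec fun y : ((ℕ × List Bool) × ℕ) × List Bool => y.1.1.2 :=
      Primrec.snd.comp (Primrec.fst.comp Primrec.fst)
    have hi : Primrec fun y : ((ℕ × List Bool) × ℕ) × List Bool => y.1.2 :=
      Primrec.snd.comp Primrec.fst
    have hp : Primrec fun y : ((ℕ × List Bool) × ℕ) × List Bool => y.2.length :=
      Primrec.list_length.comp Primrec.snd
    refine (Primrec.cond (Primrec.and.comp (PrimrecRel.comp Primrec.nat_le hp hn).decide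
      (PrimrecRel.comp Primrec.eq
        (Nat.Partrec.Code.primrec_evaln.comp ((hn.pair (Primrec.const c)).pair hi))
        (Primrec.option_some.comp (Primrec.encode.comp hs))).decide)
      (primrec_two_pow.comp (Primrec.nat_sub.comp hn hp)) (Primrec.const 0)).to₂
  · intro x
    unfold stageTerm
    cases Encodable.decode₂ (List Bool) x.2 <;> rfl

theorem primrec_stageSum (c : Code) :
    Primrec fun x : ℕ × List Bool => stageSum c x.1 x.2 :=
  Primrec.nat_rec' (h := fun (x : ℕ × List Bool) (y : ℕ × ℕ) => y.2 + stageTerm c x.1 x.2 y.1)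
    Primrec.fst (Primrec.const 0)
    (Primrec.nat_add.comp (Primrec.snd.comp Primrec.snd)
      ((primrec_stageTerm c).comp (Primrec.fst.pair (Primrec.fst.comp Primrec.snd)))).to₂

/-- The set of programs that are found within `n` steps to be programs for `s` of length at most
`n`. -/
def foundPrograms (c : Code) (n : ℕ) (s : List Bool) : Set (List Bool) :=
  {p | p.length ≤ n ∧ Encodable.encode s ∈ c.evaln n (Encodable.encode p)}

/-- The cap `p.length ≤ n` makes the truncated subtraction in the exponent exact, so `2^n` is a
common denominator. -/
theorem stageTerm_encode (c : Code) (n : ℕ) (s p : List Bool) :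
    (stageTerm c n s (Encodable.encode p) : ℝ) / 2 ^ n =
      (foundPrograms c n s).indicator (fun p => (2 : ℝ)⁻¹ ^ p.length) p := by
  classical
  rw [Set.indicator_apply]
  simp only [stageTerm, Encodable.decode₂_encode, Option.elim_some, foundPrograms,
    Set.mem_ofPred_eq, Option.mem_def, Bool.cond_eq_ite, Bool.and_eq_true, decide_eq_true_eq]
  split_ifs with h
  · have h2 : (2 : ℝ) ^ n = 2 ^ (n - p.length) * 2 ^ p.length := by
      rw [← pow_add, Nat.sub_add_cancel h.1]
    rw [h2, inv_pow]
    push_cast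
    field_simp
  · simp

theorem hasSum_stageSum (c : Code) (n : ℕ) (s : List Bool) :
    HasSum ((foundPrograms c n s).indicator fun p => (2 : ℝ)⁻¹ ^ p.length)
      ((stageSum c n s : ℝ) / 2 ^ n) := by
  have hzero : ∀ i ∉ Set.range (Encodable.encode : List Bool → ℕ), stageTerm c n s i = 0 := by
    intro i hi
    have : Encodable.decode₂ (List Bool) i = none := by
      rw [Option.eq_none_iff_forall_not_mem]
      intro x hx
      exact hi ⟨x, Encodable.mem_decode₂.1 hx⟩
    simp [stageTerm, this]
  -- Evaluation with bound `n` succeeds only on inputs below `n`, so the finite sum misses nothing.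
  have hlarge : ∀ i ∉ Finset.range n, stageTerm c n s i = 0 := by
    intro i hi
    unfold stageTerm
    cases Encodable.decode₂ (List Bool) i with
    | none => rfl
    | some p =>
      have : c.evaln n i ≠ some (Encodable.encode s) := fun h =>
        hi (Finset.mem_range.2 (Nat.Partrec.Code.evaln_bound (Option.mem_def.2 h)))
      simp [this]
  have h : HasSum (fun i => (stageTerm c n s i : ℝ) / 2 ^ n) ((stageSum c n s : ℝ) / 2 ^ n) := by
    rw [stageSum_eq_sum, Nat.cast_sum, Finset.sum_div]
    exact hasSum_sum_of_ne_finset_zero fun i hi => by simp [hlarge i hi]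
  rw [← (Encodable.encode_injective (α := List Bool)).hasSum_iff] at h
  · convert h using 1
    ext p
    exact (stageTerm_encode c n s p).symm
  · intro i hi
    simp [hzero i hi]

/-- Every program for `s` is found from some stage on and nothing false is ever found, so the stage
sums converge by dominated convergence, with the full series as the bound. -/
theorem exists_recursive_approx_algProb {U : List Bool →. List Bool} (hU : IsComputer U) :
    ∃ a : ℕ × List Bool → ℚ, IsRecursiveRat a ∧
      ∀ s, Filter.Tendsto (fun n => (a (n, s) : ℝ)) Filter.atTop (nhds (algProb U s).toReal) ∧
        ∀ n, (a (n, s) : ℝ) ≤ (algProb U s).toReal := by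
  obtain ⟨c, hc⟩ := Nat.Partrec.Code.exists_code.1 hU.partrec
  have heval : ∀ p s : List Bool,
      Encodable.encode s ∈ c.eval (Encodable.encode p) ↔ s ∈ U p := by
    intro p s
    rw [hc]
    simp
  have hsub : ∀ n s, foundPrograms c n s ⊆ {p | s ∈ U p} := fun n s p hp =>
    (heval p s).1 (Nat.Partrec.Code.evaln_sound hp.2)
  have hcast : ∀ n s, (((stageSum c n s : ℚ) / 2 ^ n : ℚ) : ℝ) = (stageSum c n s : ℝ) / 2 ^ n := by
    intro n s
    push_cast
    rfl
  refine ⟨fun x => (stageSum c x.1 x.2 : ℚ) / 2 ^ x.1,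
    -- A code `(x, y, d)` has denominator `d + 1`, hence `2 ^ n - 1` in the last place.
    ⟨fun x => (stageSum c x.1 x.2, 0, 2 ^ x.1 - 1), ?_, ?_⟩, fun s => ⟨?_, fun n => ?_⟩⟩
  · exact ((primrec_stageSum c).pair ((Primrec.const 0).pair
      (Primrec.nat_sub.comp (primrec_two_pow.comp Primrec.fst) (Primrec.const 1)))).to_comp
  · intro x
    have : (((2 ^ x.1 - 1 : ℕ) : ℚ)) + 1 = 2 ^ x.1 := by
      rw [Nat.cast_sub Nat.one_le_two_pow]
      push_cast
      ring
    simp only [this]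
    simp
  · simp only [hcast]
    simp only [← (hasSum_stageSum c _ s).tsum_eq, ← (hasSum_algProb hU s).tsum_eq]
    refine tendsto_tsum_of_dominated_convergence (hasSum_algProb hU s).summable (fun p => ?_)
      (Filter.Eventually.of_forall fun n p => ?_)
    · refine tendsto_const_nhds.congr' ?_
      by_cases hp : s ∈ U p
      · obtain ⟨k, hk⟩ := Nat.Partrec.Code.evaln_complete.1 ((heval p s).2 hp)
        filter_upwards [Filter.eventually_ge_atTop (max k p.length)] with n hn
        have hfound : p ∈ foundPrograms c n s :=
          ⟨(le_max_right _ _).trans hn,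
            Nat.Partrec.Code.evaln_mono ((le_max_left _ _).trans hn) hk⟩
        rw [Set.indicator_of_mem hfound, Set.indicator_of_mem (show p ∈ {p | s ∈ U p} from hp)]
      · refine Filter.Eventually.of_forall fun n => ?_
        simp only
        rw [Set.indicator_of_notMem (show p ∉ {p | s ∈ U p} from hp),
          Set.indicator_of_notMem fun h => hp (hsub n s h)]
    · rw [Real.norm_of_nonneg (Set.indicator_nonneg (fun _ _ => by positivity) p)]
      exact Set.indicator_le_indicator_of_subset (hsub n s) (fun _ => by positivity) p
  · simp only [hcast]
    exact hasSum_le (Set.indicator_le_indicator_of_subset (hsub n s) fun _ => by positivity)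
      (hasSum_stageSum c n s) (hasSum_algProb hU s)

theorem isRecursiveRat_zero {α : Type} [Primcodable α] : IsRecursiveRat fun _ : α => 0 :=
  ⟨fun _ => (0, 0, 0), Computable.const _, fun _ => by simp⟩

theorem isLowerComputable_algProb_smul_one {U : List Bool →. List Bool} (hU : IsComputer U)
    (N : ℕ) :
    IsLowerComputable fun s => (algProb U s).toReal • (1 : Matrix (Fin N) (Fin N) ℂ) := by
  have hsmul : ∀ q : ℝ, 0 ≤ q → (q • (1 : Matrix (Fin N) (Fin N) ℂ)).PosSemidef := fun q hq =>
    Matrix.PosSemidef.one.smul hq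
  refine ⟨⟨fun s => hsmul _ ENNReal.toReal_nonneg, (summable_algProb hU).smul_const _, ?_⟩, ?_⟩
  · rw [(summable_algProb hU).tsum_smul_const]
    have h := hsmul _ (sub_nonneg.2 (tsum_toReal_algProb_le_one hU))
    rwa [sub_smul, one_smul] at h
  · obtain ⟨a, ha, hlim⟩ := exists_recursive_approx_algProb hU
    refine ⟨fun n s => (a (n, s) : ℝ) • 1, ⟨fun n s => ?_, fun i j => ?_⟩, fun s => ⟨?_, ?_⟩⟩
    · exact Matrix.isHermitian_one.smul (IsSelfAdjoint.all (a (n, s) : ℝ))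
    · by_cases hij : i = j
      · subst hij
        exact ⟨a, fun _ => 0, ha, isRecursiveRat_zero, fun n s => by simp⟩
      · exact ⟨fun _ => 0, fun _ => 0, isRecursiveRat_zero, isRecursiveRat_zero,
          fun n s => by simp [hij]⟩
    · exact (hlim s).1.smul_const _
    · intro n
      have h := hsmul _ (sub_nonneg.2 ((hlim s).2 n))
      rwa [sub_smul] at h

/-! ### Comparison of the complexity with the outcome probabilities -/

/-- Requesting the string with code `k` at weight `2^{-(k+1)}` stays within total weight one.
Through optimality this makes every complexity finite. -/
theorem exists_computer_surjective :
    ∃ C : List Bool →. List Bool, IsComputer C ∧ ∀ s, ∃ p, s ∈ C p := by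
  have hreq : Computable fun k : ℕ =>
      (Encodable.decode (α := List Bool) k).map fun s => (k + 1, s) :=
    Computable.option_map Computable.decode
      ((Computable.succ.comp Computable.fst).pair Computable.snd).to₂
  obtain ⟨C, hC, h⟩ := exists_computer_of_requests hreq fun k => by
    have hle : ∀ j, requestWeight ((Encodable.decode (α := List Bool) j).map fun s => (j + 1, s)) ≤
        (2 : ℝ)⁻¹ ^ (j + 1) := by
      intro j
      cases Encodable.decode (α := List Bool) j with
      | none => simp [requestWeight]
      | some s => simp [requestWeight]
    refine (Finset.sum_le_sum fun j _ => hle j).trans ?_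
    have hgeom : ∀ k : ℕ, ∑ j ∈ Finset.range k, (2 : ℝ)⁻¹ ^ (j + 1) = 1 - (2 : ℝ)⁻¹ ^ k := by
      intro k
      induction k with
      | zero => simp
      | succ k ih => rw [Finset.sum_range_succ, ih, pow_succ]; ring
    rw [hgeom]
    have : (0 : ℝ) ≤ (2 : ℝ)⁻¹ ^ k := by positivity
    linarith
  refine ⟨C, hC, fun s => ?_⟩
  obtain ⟨p, hp, -⟩ := h (Encodable.encode s) (Encodable.encode s + 1) s (by simp)
  exact ⟨p, hp⟩

theorem IsOptimalComputer.exists_program {U : List Bool →. List Bool} (hU : IsOptimalComputer U)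
    (s : List Bool) : ∃ p, s ∈ U p := by
  obtain ⟨C, hC, h⟩ := exists_computer_surjective
  obtain ⟨d, hd⟩ := hU.simulates C hC
  obtain ⟨p, hp⟩ := h s
  obtain ⟨p', hp', -⟩ := hd p s hp
  exact ⟨p', hp'⟩

theorem exists_shortest_program {U : List Bool →. List Bool} {s : List Bool}
    (h : ∃ p, s ∈ U p) :
    ∃ p, s ∈ U p ∧ complexity U s = (p.length : ℕ∞) ∧ ∀ q, s ∈ U q → p.length ≤ q.length := by
  have : Nonempty {p // s ∈ U p} := h.elim fun p hp => ⟨⟨p, hp⟩⟩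
  let m := Function.argmin fun p : {p // s ∈ U p} => p.1.length
  have hmin : ∀ q, s ∈ U q → m.1.length ≤ q.length := fun q hq =>
    Function.argmin_le (fun p : {p // s ∈ U p} => p.1.length) ⟨q, hq⟩
  refine ⟨m.1, m.2, le_antisymm (iInf_le _ m) (le_iInf fun q => ?_), hmin⟩
  exact_mod_cast hmin q.1 q.2

/-- Diagonal entries of positive semidefinite matrices are nonnegative, so the bounds `f n s ≤ R s`
and `∑ R s ≤ 1` pass to the `(i, i)` entry, giving a lower-computable semimeasure. -/
theorem exists_diag_le_of_shortest {N : ℕ} {U : List Bool →. List Bool}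
    (hU : IsOptimalComputer U) {R : List Bool → Matrix (Fin N) (Fin N) ℂ}
    (hR : IsLowerComputable R) (i : Fin N) :
    ∃ b : ℝ, 0 < b ∧ ∀ s p : List Bool, (∀ q, s ∈ U q → p.length ≤ q.length) →
      (R s i i).re ≤ b * (2 : ℝ)⁻¹ ^ p.length := by
  obtain ⟨⟨hpos, hsum, hone⟩, f, hf, hlim⟩ := hR
  obtain ⟨a, b, ha, -, hab⟩ := hf.recursive i i
  have hre : ∀ n s, (f n s i i).re = a (n, s) := by
    intro n s
    rw [hab]
    simp
  have hpos' : ∀ s, 0 ≤ (R s i i).re := fun s => (Complex.le_def.1 (hpos s).diag_nonneg).1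
  have hcont : Continuous fun A : Matrix (Fin N) (Fin N) ℂ => (A i i).re :=
    Complex.continuous_re.comp (continuous_id.matrix_elem i i)
  have hHasSum : HasSum (fun s => (R s i i).re) ((∑' s, R s) i i).re :=
    hsum.hasSum.map (Complex.reAddGroupHom.comp (Matrix.entryAddMonoidHom ℂ i i)) hcont
  have hone' : ∑' s, (R s i i).re ≤ 1 := by
    rw [hHasSum.tsum_eq]
    have := (Complex.le_def.1 (hone.diag_nonneg (i := i))).1
    simpa using this
  obtain ⟨C, hC, hprog⟩ := exists_computer_of_lowerComputable ha hpos' hHasSum.summable hone'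
    (fun n s => by
      have := (Complex.le_def.1 (((hlim s).2 n).diag_nonneg (i := i))).1
      rw [Matrix.sub_apply, Complex.sub_re, hre] at this
      simpa using this)
    (fun s => by
      have := (hcont.tendsto (R s)).comp (hlim s).1
      simpa only [Function.comp_def, hre] using this)
  obtain ⟨d, hd⟩ := hU.simulates C hC
  -- The 8 comes from the threshold construction, the `2 ^ d` from simulating `C` on `U`.
  refine ⟨8 * 2 ^ d, by positivity, fun s p hp => ?_⟩
  -- A string of weight zero need not have a program for `C`, but then the bound is trivial.
  rcases (hpos' s).eq_or_lt with h0 | h0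
  · rw [← h0]
    positivity
  · obtain ⟨q, hq, hle⟩ := hprog s h0
    obtain ⟨q', hq', hlen⟩ := hd q s hq
    have hpq : p.length ≤ q.length + d := (hp q' hq').trans hlen
    refine hle.trans ?_
    have h1 : (2 : ℝ)⁻¹ ^ (q.length + d) ≤ (2 : ℝ)⁻¹ ^ p.length :=
      pow_le_pow_of_le_one (by norm_num) (by norm_num) hpq
    have h2 : (2 : ℝ) ^ d * (2 : ℝ)⁻¹ ^ (q.length + d) = (2 : ℝ)⁻¹ ^ q.length := by
      rw [pow_add, inv_pow, inv_pow]
      field_simp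
    rw [← h2, mul_assoc]
    gcongr

theorem exists_trace_le_of_shortest {N : ℕ} {U : List Bool →. List Bool}
    (hU : IsOptimalComputer U) {R : List Bool → Matrix (Fin N) (Fin N) ℂ}
    (hR : IsLowerComputable R) :
    ∃ b : ℝ, 0 < b ∧ ∀ s p : List Bool, (∀ q, s ∈ U q → p.length ≤ q.length) →
      (R s).trace.re ≤ b * (2 : ℝ)⁻¹ ^ p.length := by
  choose b hb hle using exists_diag_le_of_shortest hU hR
  -- The extra 1 keeps the constant positive when `N = 0`.
  refine ⟨1 + ∑ i, b i, add_pos_of_pos_of_nonneg one_pos (Finset.sum_nonneg fun i _ => (hb i).le),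
    fun s p hp => ?_⟩
  rw [Matrix.trace, Complex.re_sum]
  calc ∑ i, ((R s).diag i).re ≤ ∑ i, b i * (2 : ℝ)⁻¹ ^ p.length :=
        Finset.sum_le_sum fun i _ => hle i s p hp
    _ = (∑ i, b i) * (2 : ℝ)⁻¹ ^ p.length := (Finset.sum_mul _ _ _).symm
    _ ≤ _ := by
        gcongr
        exact le_add_of_nonneg_left zero_le_one

theorem abs_add_logb_le {a b x : ℝ} {k : ℕ} (ha : 0 < a) (hb : 0 < b)
    (h₁ : a * (2 : ℝ)⁻¹ ^ k ≤ x) (h₂ : x ≤ b * (2 : ℝ)⁻¹ ^ k) :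
    |(k : ℝ) - (-Real.logb 2 x)| ≤ |Real.logb 2 a| + |Real.logb 2 b| := by
  have hpow : (0 : ℝ) < (2 : ℝ)⁻¹ ^ k := by positivity
  have hlog : ∀ c : ℝ, 0 < c → Real.logb 2 (c * (2 : ℝ)⁻¹ ^ k) = Real.logb 2 c - k := by
    intro c hc
    rw [Real.logb_mul hc.ne' hpow.ne', Real.logb_pow, Real.logb_inv,
      Real.logb_self_eq_one one_lt_two]
    ring
  have hx : 0 < x := (mul_pos ha hpow).trans_le h₁
  have h₁' := Real.logb_le_logb_of_le one_lt_two (mul_pos ha hpow) h₁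
  have h₂' := Real.logb_le_logb_of_le one_lt_two hx h₂
  rw [hlog a ha] at h₁'
  rw [hlog b hb] at h₂'
  rw [abs_le]
  constructor
  · linarith [neg_abs_le (Real.logb 2 a), abs_nonneg (Real.logb 2 b)]
  · linarith [le_abs_self (Real.logb 2 b), abs_nonneg (Real.logb 2 a)]

end SemiPOVM

theorem mainTheorem6 (N : ℕ) (hN : 0 < N)
    (U : List Bool →. List Bool) (hU : SemiPOVM.IsOptimalComputer U)
    (M : List Bool → Matrix (Fin N) (Fin N) ℂ) (hM : SemiPOVM.IsUniversal M) :
    (∃ c : ℝ, 0 < c ∧ ∀ ρ : Matrix (Fin N) (Fin N) ℂ, SemiPOVM.IsDensityMatrix ρ →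
      ∀ s : List Bool, 0 < SemiPOVM.outcomeProb ρ (M s) ∧
        ∃ k : ℕ, SemiPOVM.complexity U s = (k : ℕ∞) ∧
          |(k : ℝ) - (-Real.logb 2 (SemiPOVM.outcomeProb ρ (M s)))| ≤ c) ∧
    (∃ c : ℝ, 0 < c ∧ ∀ ρ : Matrix (Fin N) (Fin N) ℂ, SemiPOVM.IsDensityMatrix ρ →
      ∀ s : List Bool, SemiPOVM.algProb U s ≠ ⊤ ∧
        c * (SemiPOVM.algProb U s).toReal ≤ SemiPOVM.outcomeProb ρ (M s) ∧
        c * SemiPOVM.outcomeProb ρ (M s) ≤ (SemiPOVM.algProb U s).toReal) := by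
  obtain ⟨b, hb, hupper⟩ := SemiPOVM.exists_trace_le_of_shortest hU hM.isLowerComputable
  obtain ⟨a, ha, hlower⟩ := hM.dominates _
    (SemiPOVM.isLowerComputable_algProb_smul_one hU.isComputer N)
  have hpos : ∀ s, (M s).PosSemidef := hM.isLowerComputable.isSemiPOVM.posSemidef
  have hlow : ∀ ρ, SemiPOVM.IsDensityMatrix ρ → ∀ s,
      a * (SemiPOVM.algProb U s).toReal ≤ SemiPOVM.outcomeProb ρ (M s) := fun ρ hρ s =>
    SemiPOVM.le_outcomeProb_of_posSemidef_sub_smul_one hρ (by rw [mul_smul]; exact hlower s)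
  -- From here on `2^{-|p s|}` plays the role of `2^{-K(s)}`.
  choose p hp hcomplexity hmin using fun s =>
    SemiPOVM.exists_shortest_program (hU.exists_program s)
  have hprob : ∀ s, (2 : ℝ)⁻¹ ^ (p s).length ≤ (SemiPOVM.algProb U s).toReal := fun s =>
    SemiPOVM.two_inv_pow_le_algProb hU.isComputer (hp s)
  have hup : ∀ ρ, SemiPOVM.IsDensityMatrix ρ → ∀ s,
      SemiPOVM.outcomeProb ρ (M s) ≤ b * (2 : ℝ)⁻¹ ^ (p s).length := fun ρ hρ s =>
    (SemiPOVM.outcomeProb_le_trace hρ (hpos s)).trans (hupper s (p s) (hmin s))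
  have hlow' : ∀ ρ, SemiPOVM.IsDensityMatrix ρ → ∀ s,
      a * (2 : ℝ)⁻¹ ^ (p s).length ≤ SemiPOVM.outcomeProb ρ (M s) := fun ρ hρ s =>
    (mul_le_mul_of_nonneg_left (hprob s) ha.le).trans (hlow ρ hρ s)
  -- The `+ 1` ensures positivity when both logarithms vanish; `min a b⁻¹` serves both directions of
  -- the comparison with `P`.
  refine ⟨⟨|Real.logb 2 a| + |Real.logb 2 b| + 1, by positivity, fun ρ hρ s => ⟨?_, (p s).length,
    hcomplexity s, ?_⟩⟩, ⟨min a b⁻¹, by positivity, fun ρ hρ s =>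
    ⟨SemiPOVM.algProb_ne_top hU.isComputer s, ?_, ?_⟩⟩⟩
  · exact lt_of_lt_of_le (by positivity) (hlow' ρ hρ s)
  · linarith [SemiPOVM.abs_add_logb_le ha hb (hlow' ρ hρ s) (hup ρ hρ s)]
  · exact (mul_le_mul_of_nonneg_right (min_le_left _ _) ENNReal.toReal_nonneg).trans (hlow ρ hρ s)
  · have h0 : 0 ≤ SemiPOVM.outcomeProb ρ (M s) :=
      SemiPOVM.outcomeProb_nonneg hρ.posSemidef (hpos s)
    refine (mul_le_mul_of_nonneg_right (min_le_right _ _) h0).trans ?_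
    rw [inv_mul_le_iff₀ hb]
    exact (hup ρ hρ s).trans (mul_le_mul_of_nonneg_left (hprob s) hb.le)
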